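/- Let $\mathcal C=(G,p)$ be a crystal framework in $\mathbb R^d$: $G=(V,E)$ is a countable simple graph and $p:V\to\mathbb R^d$ is injective and periodic for some $d$ linearly independent translations, with finitely many translation classes of joints and bars. Let $\mathcal F(\mathcal C;\mathbb C)$ be the space of all $u:V\to\mathbb C^d$ with $(u(v)-u(w))\cdot(p(v)-p(w))=0$ for all $vw\in E$ (bilinear dot product), and give the space of all functions $V\to\mathbb C^d$ the topology of pointwise convergence. Fix a periodic structure, that is, $d$ linearly independent periodicity vectors $a_1,\dots,a_d$ of $\mathcal C$, and a motif: representatives $v_1,\dots,v_n$ and $e_1,\dots,e_m$ of the translation classes of joints and bars. Label the vertices by pairs $(v_i,k)$, $k\in\mathbb Z^d$, where $p(v_i,k)=p(v_i)+k_1a_1+\dots+k_da_d$, and identify a function $u:V\to\mathbb C^d$ with the multi-sequence $u:\mathbb Z^d\to\mathbb C^{dn}$, $u(k)=(u(v_1,k),\dots,u(v_n,k))$. Write $\mathbb C_*=\mathbb C\setminus\{0\}$. A vectorial pg-sequence with geometric index $\omega\in\mathbb C_*^d$ is a function $u_{\omega,h}:k\mapsto\omega^kh(k)$ with $h\in\mathbb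 C[z_1,\dots,z_d]\otimes\mathbb C^{dn}$. Let $\mathbb C(z)$ be the ring of Laurent polynomials in $z_1,\dots,z_d$. The transfer function $\Psi(z)$ is the $m\times dn$ matrix over $\mathbb C(z)$ in which the row of the motif bar $e=(v,k)(w,l)$ is $p(e)z^{-k}$ in the $d$ columns of $v$ plus $-p(e)z^{-l}$ in the $d$ columns of $w$ (these are added if $v=w$), and $0$ elsewhere, where $p(e)=p(v,k)-p(w,l)$. Let $M(\mathcal C)\subseteq\mathbb C(z)\otimes\mathbb C^{dn}$ be the $\mathbb C(z)$-module generated by the rows of $\Psi(z)$ and let $M'(\mathcal C)$ be the one generated by the rows of $\Psi(z^{-1})$. Let $M(\mathcal C)^*$ and $M'(\mathcal C)^*$ be their intersections with $\mathbb C[z]\otimes\mathbb C^{dn}$; these are $\mathbb C[z]$-modules. A root sequence for a $\mathbb C[z]$-submodule $N$ of $\mathbb C[z]\otimes\mathbb C^{dn}$ is a sequence $\omega(1),\dots,\omega(s)$ in $\mathbb C^d$ for which there is a primary decomposition $N=Q_1\cap\dots\cap Q_s$, with $Q_i$ a $P_i$-primary submodule of $\mathbb C[z]\otimes\mathbb C^{dn}$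 and $P_1,\dots,P_s$ distinct primes, such that $q(\omega(i))=0$ for all $q\in P_i$ and all $i$. Then: (1) $\mathcal F(\mathcal C;\mathbb C)$ is the closed linear span of the vectorial pg-sequences $u_{\omega,h}$, $\omega\in\mathbb C_*^d$, that belong to $\mathcal F(\mathcal C;\mathbb C)$. (2) If $\omega(1),\dots,\omega(s)\in\mathbb C_*^d$ is a root sequence for $M(\mathcal C)^*$, then $\mathcal F(\mathcal C;\mathbb C)$ is the closed linear span of the vectorial pg-sequences in $\mathcal F(\mathcal C;\mathbb C)$ with geometric indices among the coordinatewise inverses $\omega(1)^{-1},\dots,\omega(s)^{-1}$. (3) If $\omega(1),\dots,\omega(s)\in\mathbb C_*^d$ is a root sequence for $M'(\mathcal C)^*$, then $\mathcal F(\mathcal C;\mathbb C)$ is the closed linear span of the vectorial pg-sequences in $\mathcal F(\mathcal C;\mathbb C)$ with geometric indices among $\omega(1),\dots,\omega(s)$. -/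

import Mathlib

/-- The translation vector `k₁ a₁ + ⋯ + k_d a_d`. -/
def latticeVec {d : ℕ} (a : Fin d → EuclideanSpace ℝ (Fin d)) (k : Fin d → ℤ) :
    EuclideanSpace ℝ (Fin d) :=
  ∑ i, (k i : ℝ) • a i

/-- `t` is a periodicity vector of the bar-joint framework `(G, p)` (with `p` injective): translation
by `t` maps the set of joints onto itself and preserves bars. -/
def IsPeriod {d : ℕ} {V : Type*} (G : SimpleGraph V) (p : V → EuclideanSpace ℝ (Fin d))
    (t : EuclideanSpace ℝ (Fin d)) : Prop :=
  (∀ v, ∃ w, p w = p v + t) ∧ (∀ v, ∃ w, p v = p w + t) ∧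
    ∀ v w v' w', p v' = p v + t → p w' = p w + t → (G.Adj v w ↔ G.Adj v' w')

/-- A crystal framework in `ℝ^d`: a countable simple graph with an injective placement of its
vertices which is periodic for some `d` linearly independent translations, with finitely many
translation classes of joints and of bars. -/
structure CrystalFramework (d : ℕ) (V : Type*) where
  graph : SimpleGraph V
  placement : V → EuclideanSpace ℝ (Fin d)
  countable : Countable V
  injective : Function.Injective placement
  crystallographic : ∃ a : Fin d → EuclideanSpace ℝ (Fin d), LinearIndependent ℝ a ∧
    (∀ i, IsPeriod graph placement (a i)) ∧
    (∃ S : Finset V, ∀ v, ∃ w ∈ S, ∃ k, placement v = placement w + latticeVec a k) ∧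
    (∃ T : Finset (V × V), ∀ v w, graph.Adj v w → ∃ e ∈ T, graph.Adj e.1 e.2 ∧ ∃ k,
      placement v = placement e.1 + latticeVec a k ∧
      placement w = placement e.2 + latticeVec a k)

/-- The complex infinitesimal flex space: the `ℂ^d`-valued functions `u` on the joints with
`(u(p(v)) - u(p(w))) · (p(v) - p(w)) = 0` for all bars (the dot product is bilinear). -/
def CrystalFramework.flexSpace {d : ℕ} {V : Type*} (C : CrystalFramework d V) :
    Submodule ℂ (V → Fin d → ℂ) where
  carrier := {u | ∀ v w, C.graph.Adj v w →
    ∑ j, (u v j - u w j) * ((C.placement v j - C.placement w j : ℝ) : ℂ) = 0}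
  zero_mem' := by
    intro v w _
    simp
  add_mem' := by
    intro u u' hu hu' v w h
    have h1 := hu v w h
    have h2 := hu' v w h
    rw [← add_zero (0 : ℂ)]
    nth_rewrite 1 [← h1]
    rw [← h2, ← Finset.sum_add_distrib]
    refine Finset.sum_congr rfl fun j _ => ?_
    simp only [Pi.add_apply]
    ring
  smul_mem' := by
    intro c u hu v w h
    have h1 := hu v w h
    rw [← mul_zero c, ← h1, Finset.mul_sum]
    refine Finset.sum_congr rfl fun j _ => ?_
    simp only [Pi.smul_apply, smul_eq_mul]
    ring

/-- A periodic structure: a choice of `d` linearly independent periodicity vectors. -/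
structure PeriodicStructure {d : ℕ} {V : Type*} (C : CrystalFramework d V) where
  vec : Fin d → EuclideanSpace ℝ (Fin d)
  linearIndependent : LinearIndependent ℝ vec
  isPeriod : ∀ i, IsPeriod C.graph C.placement (vec i)

/-- A labelled motif for a periodic structure, with `n` joints and `m` bars. The vertex
`label (v, k)` is placed at the translate by `k₁ a₁ + ⋯ + k_d a_d` of the motif joint `(v, 0)`.
The motif bar `e` joins the vertices labelled `src e` and `tgt e`, and each bar of the framework is
the translate of exactly one motif bar by exactly one lattice vector. -/
structure Motif {d : ℕ} {V : Type*} {C : CrystalFramework d V} (A : PeriodicStructure C)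
    (n m : ℕ) where
  label : Fin n × (Fin d → ℤ) ≃ V
  placement_label : ∀ v k,
    C.placement (label (v, k)) = C.placement (label (v, 0)) + latticeVec A.vec k
  src : Fin m → Fin n × (Fin d → ℤ)
  tgt : Fin m → Fin n × (Fin d → ℤ)
  adj : ∀ e, C.graph.Adj (label (src e)) (label (tgt e))
  existsUnique_bar : ∀ x y, C.graph.Adj x y → ∃! ek : Fin m × (Fin d → ℤ),
    s(x, y) = s(label ((src ek.1).1, (src ek.1).2 + ek.2), label ((tgt ek.1).1, (tgt ek.1).2 + ek.2))

/-- The Laurent polynomial ring in `d` variables: finite sums `∑ a_k z^k` with `k ∈ ℤ^d`. -/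
abbrev Laurent (d : ℕ) : Type := AddMonoidAlgebra ℂ (Fin d → ℤ)

/-- The inclusion of the polynomial ring in the Laurent polynomial ring. -/
noncomputable def toLaurent (d : ℕ) : MvPolynomial (Fin d) ℂ →ₐ[ℂ] Laurent d :=
  MvPolynomial.aeval fun i => AddMonoidAlgebra.single (Pi.single i 1) 1

/-- The substitution `z ↦ z⁻¹` in a Laurent polynomial. -/
noncomputable def laurentInv (d : ℕ) : Laurent d →+* Laurent d :=
  AddMonoidAlgebra.mapDomainRingHom ℂ (negAddMonoidHom : (Fin d → ℤ) →+ (Fin d → ℤ))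

namespace Motif

variable {d : ℕ} {V : Type*} {C : CrystalFramework d V} {A : PeriodicStructure C} {n m : ℕ}

/-- The bar vector `p(e) = p(v,k) - p(w,l)` of the motif bar `e = (v,k)(w,l)`. -/
noncomputable def barVec (M : Motif A n m) (e : Fin m) : EuclideanSpace ℝ (Fin d) :=
  C.placement (M.label (M.src e)) - C.placement (M.label (M.tgt e))

/-- The transfer function: the row of `e = (v,k)(w,l)` has the entries `p(e) z^{-k}` in the columns
of `v` and `-p(e) z^{-l}` in the columns of `w`, which add up to `p(e)(z^{-k} - z^{-l})` if
`v = w`, and zeros elsewhere. -/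
noncomputable def transferFunction (M : Motif A n m) :
    Matrix (Fin m) (Fin n × Fin d) (Laurent d) :=
  fun e c =>
    (if c.1 = (M.src e).1 then
      AddMonoidAlgebra.single (-(M.src e).2) ((M.barVec e c.2 : ℝ) : ℂ) else 0) -
    (if c.1 = (M.tgt e).1 then
      AddMonoidAlgebra.single (-(M.tgt e).2) ((M.barVec e c.2 : ℝ) : ℂ) else 0)

/-- The velocity field which in the coordinates of the motif is the vectorial pg-sequence
`k ↦ ω^k h(k)`, where `h` is a vector-valued polynomial. -/
noncomputable def pgField (M : Motif A n m) (ω : Fin d → ℂˣ)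
    (h : Fin n × Fin d → MvPolynomial (Fin d) ℂ) : V → Fin d → ℂ :=
  fun x j =>
    (∏ i, ((ω i ^ (M.label.symm x).2 i : ℂˣ) : ℂ)) *
      MvPolynomial.eval (fun i => (((M.label.symm x).2 i : ℤ) : ℂ)) (h ((M.label.symm x).1, j))

end Motif

/-- The submodule generated over the Laurent polynomial ring by the rows of a matrix. -/
noncomputable def rowModule {d m : ℕ} {ι : Type*} (Ψ : Matrix (Fin m) ι (Laurent d)) :
    Submodule (Laurent d) (ι → Laurent d) :=
  Submodule.span (Laurent d) (Set.range Ψ)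

/-- The module `B* = B ∩ (ℂ[z] ⊗ ℂ^ι)` of the polynomial vectors in `B`. -/
noncomputable def polyPart {d : ℕ} {ι : Type*} (B : Submodule (Laurent d) (ι → Laurent d)) :
    Submodule (MvPolynomial (Fin d) ℂ) (ι → MvPolynomial (Fin d) ℂ) where
  carrier := {f | (fun c => toLaurent d (f c)) ∈ B}
  zero_mem' := by
    have h : (fun c => toLaurent d ((0 : ι → MvPolynomial (Fin d) ℂ) c)) = 0 := by
      funext c
      simp
    simp only [Set.mem_ofPred_eq, h, B.zero_mem]
  add_mem' := by
    intro f g hf hg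
    have h : (fun c => toLaurent d ((f + g) c)) =
        (fun c => toLaurent d (f c)) + fun c => toLaurent d (g c) := by
      funext c
      simp
    simp only [Set.mem_ofPred_eq, h]
    exact B.add_mem hf hg
  smul_mem' := by
    intro q f hf
    have h : (fun c => toLaurent d ((q • f) c)) =
        toLaurent d q • fun c => toLaurent d (f c) := by
      funext c
      simp
    simp only [Set.mem_ofPred_eq, h]
    exact B.smul_mem _ hf

/-- `Q` is a `P`-primary submodule: `Q` is primary and `P` is the ideal of the ring elements which
act nilpotently on the quotient by `Q`. -/
def IsPrimaryFor {R N : Type*} [CommRing R] [AddCommGroup N] [Module R N]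
    (Q : Submodule R N) (P : Ideal R) : Prop :=
  Q.IsPrimary ∧ ∀ r : R, r ∈ P ↔ ∃ t : ℕ, ∀ x : N, r ^ t • x ∈ Q

/-- `ω(1), …, ω(s)` is a root sequence for `M`: there is a primary decomposition
`M = Q₁ ∩ ⋯ ∩ Q_s`, with `Q_i` being `P_i`-primary for distinct `P_i`, such that `ω(i)` is a common
zero of the polynomials in `P_i`. -/
def IsRootSequence {d : ℕ} {ι : Type*}
    (M : Submodule (MvPolynomial (Fin d) ℂ) (ι → MvPolynomial (Fin d) ℂ))
    {s : ℕ} (ω : Fin s → Fin d → ℂ) : Prop :=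
  ∃ (Q : Fin s → Submodule (MvPolynomial (Fin d) ℂ) (ι → MvPolynomial (Fin d) ℂ))
    (P : Fin s → Ideal (MvPolynomial (Fin d) ℂ)),
    M = ⨅ i, Q i ∧ (∀ i, IsPrimaryFor (Q i) (P i)) ∧ Function.Injective P ∧
      ∀ i, ∀ q ∈ P i, MvPolynomial.eval (ω i) q = 0

/-! Duality and commutative algebra. Under `pairing`, velocity fields are the linear functionals on
the Laurent vectors, and Laurent vectors are the functionals on fields that see only finitely many
joints. The flex space is the annihilator of `B`, the row module of `Ψ(z⁻¹)`. By a bipolar argument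
(`topologicalClosure_span_eq`), a set of flexes has dense span as soon as every `f ∉ B` pairs
nontrivially with one of them.

Suppose the ideal `(B : f)` vanishes at a point `ω` of the torus, with maximal ideal `m`. Krull's
intersection theorem gives `t` with `f ∉ B + m^t`, hence a functional that kills `B` and `m^t` but
not `f`. Modulo `m^t` each `z_i / ω_i` is unipotent, so its powers are polynomial in the exponent;
the functional is therefore a pg-sequence of index `ω` (`exists_pgField_separating`).

It remains to find `ω`. For (1), `(B : f)` is proper and the Nullstellensatz applies. For (3), clear
denominators in `f` by a monomial; the result lies outside some primary component `Q_i`, so all its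
multipliers into `B*` lie in `P_i` and vanish at `ω(i)`. For (2), the substitution `z ↦ z⁻¹`
exchanges the two row modules and inverts points. -/

/-! ### Functionals vanishing on a power of a maximal ideal -/

/-- The binomial coefficient `k ↦ choose k j` on the integers is given by a complex polynomial. -/
theorem exists_polynomial_eval_eq_choose (j : ℕ) :
    ∃ b : Polynomial ℂ, ∀ k : ℤ, b.eval (k : ℂ) = ((Ring.choose k j : ℤ) : ℂ) := by
  refine ⟨Polynomial.C ((j.factorial : ℂ)⁻¹) * (descPochhammer ℤ j).map (Int.castRingHom ℂ),
    fun k => ?_⟩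
  have h := Ring.descPochhammer_eq_factorial_smul_choose k j
  rw [← Polynomial.eval_eq_smeval] at h
  have h2 : ((descPochhammer ℤ j).map (Int.castRingHom ℂ)).eval (k : ℂ) =
      (((descPochhammer ℤ j).eval k : ℤ) : ℂ) := by
    simp
  rw [Polynomial.eval_mul, Polynomial.eval_C, h2, h]
  have : (j.factorial : ℂ) ≠ 0 := by exact_mod_cast j.factorial_ne_zero
  simp only [nsmul_eq_mul, Int.cast_mul, Int.cast_natCast]
  field_simp

/-- The binomial theorem for integer powers of a unipotent element. -/
theorem eq_sum_choose_mul_pow {S : Type*} [CommRing S] {x : S} {t : ℕ} (hx : x ^ t = 0)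
    {g : ℤ → S} (h0 : g 0 = 1) (hs : ∀ k, g (k + 1) = (1 + x) * g k) (k : ℤ) :
    g k = ∑ j ∈ Finset.range t, ((Ring.choose k j : ℤ) : S) * x ^ j := by
  -- For exponent `0` the hypothesis reads `1 = 0`, so the ring is trivial.
  obtain _ | t := t
  · have h1 : (1 : S) = 0 := by simpa using hx
    rw [← mul_one (g k), h1]
    simp
  have hu : IsUnit (1 + x) := IsNilpotent.isUnit_one_add ⟨_, hx⟩
  set E : ℤ → S := fun k => ∑ j ∈ Finset.range (t + 1), ((Ring.choose k j : ℤ) : S) * x ^ j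
    with hE
  -- Pascal's rule; the top term of `x * E k` vanishes because `x ^ (t + 1) = 0`.
  have hEs : ∀ k, E (k + 1) = (1 + x) * E k := by
    intro k
    have h1 : E (k + 1) = (∑ j ∈ Finset.range t,
        ((Ring.choose k j : ℤ) : S) * x ^ (j + 1)) + E k := by
      simp only [hE]
      rw [Finset.sum_range_succ', Finset.sum_range_succ' _ t, ← add_assoc,
        ← Finset.sum_add_distrib]
      congr 1
      · refine Finset.sum_congr rfl fun j _ => ?_
        rw [Ring.choose_succ_succ]
        push_cast
        ring
      · simp
    have h2 : x * E k = ∑ j ∈ Finset.range t, ((Ring.choose k j : ℤ) : S) * x ^ (j + 1) := by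
      simp only [hE]
      rw [Finset.sum_range_succ, mul_add, Finset.mul_sum]
      have : x * (((Ring.choose k t : ℤ) : S) * x ^ t) = 0 := by
        rw [mul_left_comm, ← pow_succ', hx, mul_zero]
      rw [this, add_zero]
      exact Finset.sum_congr rfl fun j _ => by ring
    rw [h1, add_mul, one_mul, h2, add_comm]
  have hE0 : E 0 = 1 := by
    simp only [hE]
    rw [Finset.sum_range_succ', Finset.sum_eq_zero]
    · simp
    · intro j _
      rw [Ring.choose_zero_succ]
      simp
  change g k = E k
  induction k using Int.induction_on with
  | zero => rw [h0, hE0]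
  | succ k ih => rw [hs, hEs, ih]
  | pred k ih =>
    have h1 := hs (-k - 1)
    have h2 := hEs (-k - 1)
    rw [sub_add_cancel] at h1 h2
    exact hu.mul_left_cancel (by rw [← h1, ← h2, ih])

theorem single_eq_prod_single {d : ℕ} (k : Fin d → ℤ) (c : Fin d → ℂ) :
    (AddMonoidAlgebra.single k (∏ i, c i) : Laurent d) =
      ∏ i, AddMonoidAlgebra.single (Pi.single i (k i)) (c i) := by
  rw [AddMonoidAlgebra.prod_single]
  congr 1
  exact (Finset.univ_sum_single k).symm

/-- A linear functional on the Laurent polynomials which vanishes on a power of the maximal ideal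
at `ω` takes the values `ω^k h(k)` on the monomials `z^k`, for some polynomial `h`. -/
theorem exists_polynomial_of_vanish_on_pow {d : ℕ} (χ : Laurent d →ₐ[ℂ] ℂ) (ω : Fin d → ℂˣ)
    (hω : ∀ i, χ (AddMonoidAlgebra.single (Pi.single i 1) 1) = ω i) (t : ℕ)
    (ψ : Laurent d →ₗ[ℂ] ℂ) (hψ : ∀ x ∈ RingHom.ker χ ^ t, ψ x = 0) :
    ∃ h : MvPolynomial (Fin d) ℂ, ∀ k : Fin d → ℤ, ψ (AddMonoidAlgebra.single k 1) =
      (∏ i, ((ω i ^ k i : ℂˣ) : ℂ)) * MvPolynomial.eval (fun i => ((k i : ℤ) : ℂ)) h := by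
  classical
  choose b hb using exists_polynomial_eval_eq_choose
  -- `y i k` is `(z_i / ω_i) ^ k`, normalised so that `y i 1 - 1` lies in the maximal ideal.
  let y : Fin d → ℤ → Laurent d := fun i k =>
    AddMonoidAlgebra.single (Pi.single i k) (((ω i ^ (-k) : ℂˣ)) : ℂ)
  let x : Fin d → Laurent d := fun i => y i 1 - 1
  have hx : ∀ i, x i ∈ RingHom.ker χ := by
    intro i
    have : y i 1 = (((ω i)⁻¹ : ℂˣ) : ℂ) • AddMonoidAlgebra.single (Pi.single i 1) 1 := by
      simp [y]
    rw [RingHom.mem_ker, map_sub, map_one, this, map_smul, hω]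
    simp
  let q := Ideal.Quotient.mk (RingHom.ker χ ^ t)
  have hq : ∀ i k, q (y i k) = ∑ j ∈ Finset.range t,
      ((Ring.choose k j : ℤ) : Laurent d ⧸ RingHom.ker χ ^ t) * q (x i) ^ j := by
    intro i k
    refine eq_sum_choose_mul_pow (g := fun k => q (y i k)) ?_ ?_ ?_ k
    · rw [← map_pow]
      exact Ideal.Quotient.eq_zero_iff_mem.2 (Ideal.pow_mem_pow (hx i) t)
    · have : y i 0 = 1 := by simp [y, AddMonoidAlgebra.one_def]
      simp [this]
    · intro k
      have : y i (k + 1) = (1 + x i) * y i k := by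
        simp only [x, y, add_sub_cancel, AddMonoidAlgebra.single_mul_single, ← Pi.single_add,
          ← Units.val_mul, ← zpow_add]
        congr 2
        · ring
        · congr 2; ring
      simp only [this, map_mul, map_add, map_one]
  let J := Fintype.piFinset fun _ : Fin d => Finset.range t
  -- Apply `ψ` to the expansion of `∏ (1 + x_i) ^ k_i`, with exponents truncated below `t`: the
  -- coefficients are the values of `ψ` on monomials in the `x_i`, and the binomials are polynomials
  -- in `k`.
  refine ⟨∑ a ∈ J, MvPolynomial.C (ψ (∏ i, x i ^ a i)) *
    ∏ i, Polynomial.aeval (MvPolynomial.X i) (b (a i)), fun k => ?_⟩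
  have h1 : (AddMonoidAlgebra.single k 1 : Laurent d) =
      (∏ i, ((ω i ^ k i : ℂˣ) : ℂ)) • ∏ i, y i (k i) := by
    rw [← single_eq_prod_single, AddMonoidAlgebra.smul_single, smul_eq_mul,
      ← Finset.prod_mul_distrib]
    congr 1
    refine (Finset.prod_eq_one fun i _ => ?_).symm
    rw [← Units.val_mul, ← zpow_add, add_neg_cancel, zpow_zero, Units.val_one]
  have h2 : ψ (∏ i, y i (k i)) =
      ψ (∑ a ∈ J, (∏ i, ((Ring.choose (k i) (a i) : ℤ) : ℂ)) • ∏ i, x i ^ a i) := by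
    rw [← sub_eq_zero, ← map_sub]
    refine hψ _ (Ideal.Quotient.eq_zero_iff_mem.1 ?_)
    change q _ = 0
    have hc : ∀ (c : ℤ), q (algebraMap ℂ (Laurent d) (c : ℂ)) = c := by
      intro c
      rw [map_intCast, map_intCast]
    rw [map_sub, map_prod, map_sum, sub_eq_zero]
    simp_rw [hq, Finset.prod_univ_sum, Algebra.smul_def, map_mul, map_prod, hc, map_pow,
      Finset.prod_mul_distrib]
    rfl
  rw [h1, map_smul, h2, map_sum, smul_eq_mul]
  congr 1
  rw [map_sum]
  refine Finset.sum_congr rfl fun a _ => ?_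
  rw [map_smul, map_mul, MvPolynomial.eval_C, map_prod (MvPolynomial.eval _), smul_eq_mul, mul_comm]
  congr 1
  refine Finset.prod_congr rfl fun i _ => ?_
  rw [← hb]
  have h3 := Polynomial.hom_eval₂ (b (a i)) (algebraMap ℂ (MvPolynomial (Fin d) ℂ))
    (MvPolynomial.eval fun i => ((k i : ℤ) : ℂ)) (MvPolynomial.X i)
  rw [MvPolynomial.eval_X] at h3
  rw [Polynomial.aeval_def, h3, Polynomial.eval]
  congr 1
  ext
  simp [MvPolynomial.algebraMap_eq]

theorem linearMap_ext_single {ι : Type*} [Finite ι] [DecidableEq ι]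
    {φ φ' : (ι → Laurent d) →ₗ[ℂ] ℂ}
    (h : ∀ c k, φ (Pi.single c (AddMonoidAlgebra.single k 1)) =
      φ' (Pi.single c (AddMonoidAlgebra.single k 1))) : φ = φ' := by
  refine LinearMap.pi_ext fun c x => ?_
  induction x using AddMonoidAlgebra.induction_linear with
  | zero => simp
  | add f g hf hg => rw [Pi.single_add, map_add, map_add, hf, hg]
  | single k a =>
    have : (Pi.single c (AddMonoidAlgebra.single k a) : ι → Laurent d) =
        a • Pi.single c (AddMonoidAlgebra.single k 1) := by
      rw [← Pi.single_smul, AddMonoidAlgebra.smul_single, smul_eq_mul, mul_one]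
    rw [this, map_smul, map_smul, h]

/-! ### Duality between Laurent vectors and velocity fields -/

namespace Motif

variable {d : ℕ} {V : Type*} {C : CrystalFramework d V} {A : PeriodicStructure C} {n m : ℕ}

/-- The pairing of vectors of Laurent polynomials with velocity fields in which `z^k` in the
component `(v, j)` reads off the coordinate `j` of the velocity of the joint `(v, k)`. -/
noncomputable def pairing (M : Motif A n m) (u : V → Fin d → ℂ) :
    (Fin n × Fin d → Laurent d) →ₗ[ℂ] ℂ :=
  ∑ c, (Finsupp.linearCombination ℂ (fun k => u (M.label (c.1, k)) c.2) ∘ₗ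
    (AddMonoidAlgebra.coeffLinearEquiv ℂ : Laurent d ≃ₗ[ℂ] _).toLinearMap) ∘ₗ LinearMap.proj c

theorem pairing_single (M : Motif A n m) (u : V → Fin d → ℂ) (c : Fin n × Fin d)
    (k : Fin d → ℤ) (a : ℂ) :
    M.pairing u (Pi.single c (AddMonoidAlgebra.single k a)) = a * u (M.label (c.1, k)) c.2 := by
  classical
  simp only [pairing, LinearMap.sum_apply, LinearMap.comp_apply, LinearMap.proj_apply]
  rw [Finset.sum_eq_single c]
  · simp
  · intro b _ hb
    simp [hb]
  · simp

/-- A functional which vanishes on all vectors with components in a power of the maximal ideal at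
`ω` is the pairing with a vectorial pg-sequence of geometric index `ω`. -/
theorem exists_pairing_pgField_eq (M : Motif A n m) (χ : Laurent d →ₐ[ℂ] ℂ) (ω : Fin d → ℂˣ)
    (hω : ∀ i, χ (AddMonoidAlgebra.single (Pi.single i 1) 1) = ω i) (t : ℕ)
    (φ : (Fin n × Fin d → Laurent d) →ₗ[ℂ] ℂ)
    (hφ : ∀ x ∈ (RingHom.ker χ ^ t • ⊤ : Submodule (Laurent d) (Fin n × Fin d → Laurent d)),
      φ x = 0) : ∃ h, M.pairing (M.pgField ω h) = φ := by
  have key : ∀ c : Fin n × Fin d, ∃ h : MvPolynomial (Fin d) ℂ, ∀ k : Fin d → ℤ,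
      φ (Pi.single c (AddMonoidAlgebra.single k 1)) =
      (∏ i, ((ω i ^ k i : ℂˣ) : ℂ)) * MvPolynomial.eval (fun i => ((k i : ℤ) : ℂ)) h := by
    intro c
    refine exists_polynomial_of_vanish_on_pow χ ω hω t
      (φ ∘ₗ LinearMap.single ℂ (fun _ => Laurent d) c) fun x hx => hφ _ ?_
    have : (LinearMap.single ℂ (fun _ => Laurent d) c) x =
        x • (Pi.single c (1 : Laurent d) : Fin n × Fin d → Laurent d) := by
      rw [← Pi.single_smul, smul_eq_mul, mul_one, LinearMap.coe_single]
    rw [this]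
    exact Submodule.smul_mem_smul hx trivial
  choose h hh using key
  refine ⟨h, linearMap_ext_single fun c k => ?_⟩
  rw [pairing_single, one_mul, hh]
  simp [pgField]

/-- If every Laurent polynomial which multiplies `f` into `B` vanishes at `ω`, then some vectorial
pg-sequence of geometric index `ω` annihilates `B` but not `f`. -/
theorem exists_pgField_separating (M : Motif A n m)
    (B : Submodule (Laurent d) (Fin n × Fin d → Laurent d))
    (χ : Laurent d →ₐ[ℂ] ℂ) (ω : Fin d → ℂˣ)
    (hω : ∀ i, χ (AddMonoidAlgebra.single (Pi.single i 1) 1) = ω i)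
    (f : Fin n × Fin d → Laurent d) (hf : ∀ s : Laurent d, s • f ∈ B → χ s = 0) :
    ∃ h, (∀ g ∈ B, M.pairing (M.pgField ω h) g = 0) ∧ M.pairing (M.pgField ω h) f ≠ 0 := by
  have : IsNoetherianRing (Laurent d) := Algebra.FiniteType.isNoetherianRing ℂ _
  obtain ⟨t, ht⟩ : ∃ t : ℕ, B.mkQ f ∉ (RingHom.ker χ ^ t • ⊤ :
      Submodule (Laurent d) ((Fin n × Fin d → Laurent d) ⧸ B)) := by
    by_contra! hcon
    -- Krull: an element of every `m^t N` is fixed by some `r ∈ m`. Then `1 - r` multiplies `f` into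
    -- `B`, yet takes the value `1` under `χ`.
    obtain ⟨r, hr⟩ := ((RingHom.ker χ).mem_iInf_smul_pow_eq_bot_iff (B.mkQ f)).1
      ((Submodule.mem_iInf _).2 hcon)
    have h1 : (1 - (r : Laurent d)) • f ∈ B := by
      rw [← Submodule.Quotient.mk_eq_zero, ← Submodule.mkQ_apply, map_smul, sub_smul, one_smul,
        hr, sub_self]
    have h2 := hf _ h1
    rw [map_sub, map_one, (RingHom.mem_ker).1 r.2, sub_zero] at h2
    exact one_ne_zero h2
  have hnot : f ∉ (B ⊔ RingHom.ker χ ^ t • ⊤).restrictScalars ℂ := by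
    intro hmem
    apply ht
    have h3 : B.mkQ f ∈ (B ⊔ RingHom.ker χ ^ t • ⊤).map B.mkQ :=
      Submodule.mem_map_of_mem hmem
    rwa [Submodule.map_sup, Submodule.mkQ_map_self, bot_sup_eq, Submodule.map_smul'',
      Submodule.map_top, Submodule.range_mkQ] at h3
  obtain ⟨φ, hφf, hφ⟩ := Submodule.exists_le_ker_of_notMem hnot
  obtain ⟨h, hh⟩ := M.exists_pairing_pgField_eq χ ω hω t φ fun x hx =>
    hφ (Submodule.mem_sup_right hx)
  exact ⟨h, fun g hg => hh ▸ hφ (Submodule.mem_sup_left hg), hh ▸ hφf⟩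

/-- Every functional which depends on the restriction of a velocity field to finitely many joints is
the pairing with a vector of Laurent polynomials. -/
theorem exists_pairing_eq_of_finset (M : Motif A n m) (I : Finset V)
    (g : (I → Fin d → ℂ) →ₗ[ℂ] ℂ) :
    ∃ f, ∀ u : V → Fin d → ℂ, M.pairing u f = g fun x => u x := by
  classical
  refine ⟨∑ x : I, ∑ j, Pi.single ((M.label.symm x).1, j)
    (AddMonoidAlgebra.single (M.label.symm x).2 (g (Pi.single x (Pi.single j 1)))), fun u => ?_⟩
  have h : (fun x : I => u x) =
      ∑ x : I, ∑ j, u x j • (Pi.single x (Pi.single j 1) : I → Fin d → ℂ) := by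
    funext x j
    simp [Finset.sum_apply, Pi.single_apply, ite_apply]
  rw [h]
  simp only [map_sum, map_smul, pairing_single, smul_eq_mul, Prod.mk.eta, Equiv.apply_symm_apply]
  exact Finset.sum_congr rfl fun x _ => Finset.sum_congr rfl fun j _ => mul_comm _ _

/-- The bipolar theorem for a space of velocity fields defined by Laurent polynomial relations. -/
theorem topologicalClosure_span_eq (M : Motif A n m) (F : Submodule ℂ (V → Fin d → ℂ))
    (B : Submodule (Laurent d) (Fin n × Fin d → Laurent d))
    (hF : ∀ u, u ∈ F ↔ ∀ g ∈ B, M.pairing u g = 0) (hc : IsClosed (F : Set (V → Fin d → ℂ)))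
    (S : Set (V → Fin d → ℂ)) (hS : S ⊆ F)
    (hsep : ∀ f, f ∉ B → ∃ u ∈ S, M.pairing u f ≠ 0) :
    (Submodule.span ℂ S).topologicalClosure = F := by
  refine le_antisymm (Submodule.topologicalClosure_minimal _ (Submodule.span_le.2 hS) hc) ?_
  intro u hu
  rw [← SetLike.mem_coe, Submodule.topologicalClosure_coe, mem_closure_iff]
  intro O hO huO
  -- A pointwise neighbourhood constrains only the joints in a finite set `I`, so it suffices to
  -- match `u` exactly on `I` by an element of the span.
  obtain ⟨I, N, hN, hsub⟩ := isOpen_pi_iff.1 hO u huO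
  let ρ : (V → Fin d → ℂ) →ₗ[ℂ] (I → Fin d → ℂ) := LinearMap.funLeft ℂ _ Subtype.val
  by_cases hmem : ρ u ∈ (Submodule.span ℂ S).map ρ
  · obtain ⟨w, hw, hwu⟩ := hmem
    refine ⟨w, hsub fun x hx => ?_, hw⟩
    have : w x = u x := congrFun hwu ⟨x, hx⟩
    rw [this]
    exact (hN x hx).2
  · exfalso
    obtain ⟨g, hgu, hg⟩ := Submodule.exists_le_ker_of_notMem hmem
    obtain ⟨f, hf⟩ := M.exists_pairing_eq_of_finset I g
    -- The functional `g` kills the restrictions of all of `S`, so separation forces `f ∈ B`; but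
    -- then `u ∈ F` pairs to zero with `f`, against the choice of `g`.
    have hfB : f ∈ B := by
      by_contra hfB
      obtain ⟨w, hw, hne⟩ := hsep f hfB
      rw [hf] at hne
      exact hne (hg (Submodule.mem_map_of_mem (Submodule.subset_span hw)))
    exact hgu ((hf u).symm.trans ((hF u).1 hu f hfB))

end Motif

/-! ### The flex space as the annihilator of the row module -/

theorem IsPeriod.zero {d : ℕ} {V : Type*} (G : SimpleGraph V) {p : V → EuclideanSpace ℝ (Fin d)}
    (hp : Function.Injective p) : IsPeriod G p 0 := by
  refine ⟨fun v => ⟨v, by simp⟩, fun v => ⟨v, by simp⟩, fun v w v' w' hv hw => ?_⟩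
  rw [hp (hv.trans (add_zero _)), hp (hw.trans (add_zero _))]

theorem IsPeriod.add {d : ℕ} {V : Type*} {G : SimpleGraph V} {p : V → EuclideanSpace ℝ (Fin d)}
    {s t : EuclideanSpace ℝ (Fin d)} (hs : IsPeriod G p s) (ht : IsPeriod G p t) :
    IsPeriod G p (s + t) := by
  refine ⟨fun v => ?_, fun v => ?_, fun v w v' w' hv hw => ?_⟩
  · obtain ⟨w, hw⟩ := hs.1 v
    obtain ⟨x, hx⟩ := ht.1 w
    exact ⟨x, by rw [hx, hw, add_assoc]⟩
  · obtain ⟨w, hw⟩ := ht.2.1 v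
    obtain ⟨x, hx⟩ := hs.2.1 w
    exact ⟨x, by rw [hw, hx, add_assoc]⟩
  · obtain ⟨x, hx⟩ := hs.1 v
    obtain ⟨y, hy⟩ := hs.1 w
    rw [hs.2.2 v w x y hx hy]
    exact ht.2.2 x y v' w' (by rw [hv, hx, add_assoc]) (by rw [hw, hy, add_assoc])

theorem IsPeriod.neg {d : ℕ} {V : Type*} {G : SimpleGraph V} {p : V → EuclideanSpace ℝ (Fin d)}
    {t : EuclideanSpace ℝ (Fin d)} (ht : IsPeriod G p t) : IsPeriod G p (-t) := by
  refine ⟨fun v => ?_, fun v => ?_, fun v w v' w' hv hw => ?_⟩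
  · obtain ⟨w, hw⟩ := ht.2.1 v
    exact ⟨w, by rw [hw]; abel⟩
  · obtain ⟨w, hw⟩ := ht.1 v
    exact ⟨w, by rw [hw]; abel⟩
  · exact (ht.2.2 v' w' v w (by rw [hv]; abel) (by rw [hw]; abel)).symm

theorem IsPeriod.zsmul {d : ℕ} {V : Type*} {G : SimpleGraph V}
    {p : V → EuclideanSpace ℝ (Fin d)} (hp : Function.Injective p)
    {t : EuclideanSpace ℝ (Fin d)} (ht : IsPeriod G p t) (k : ℤ) : IsPeriod G p (k • t) := by
  induction k using Int.induction_on with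
  | zero => simpa using IsPeriod.zero G hp
  | succ k ih => rw [add_smul, one_smul]; exact ih.add ht
  | pred k ih => rw [sub_smul, one_smul, sub_eq_add_neg]; exact ih.add ht.neg

theorem PeriodicStructure.isPeriod_latticeVec {d : ℕ} {V : Type*} {C : CrystalFramework d V}
    (A : PeriodicStructure C) (k : Fin d → ℤ) :
    IsPeriod C.graph C.placement (latticeVec A.vec k) := by
  refine Finset.sum_induction _ (IsPeriod C.graph C.placement) (fun _ _ => IsPeriod.add)
    (IsPeriod.zero _ C.injective) fun i _ => ?_
  rw [Int.cast_smul_eq_zsmul]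
  exact (A.isPeriod i).zsmul C.injective (k i)

theorem latticeVec_add {d : ℕ} (a : Fin d → EuclideanSpace ℝ (Fin d)) (k l : Fin d → ℤ) :
    latticeVec a (k + l) = latticeVec a k + latticeVec a l := by
  simp [latticeVec, add_smul, Finset.sum_add_distrib]

namespace Motif

variable {d : ℕ} {V : Type*} {C : CrystalFramework d V} {A : PeriodicStructure C} {n m : ℕ}

theorem placement_label_add (M : Motif A n m) (v : Fin n) (k l : Fin d → ℤ) :
    C.placement (M.label (v, k + l)) = C.placement (M.label (v, k)) + latticeVec A.vec l := by
  rw [M.placement_label v (k + l), M.placement_label v k, latticeVec_add, add_assoc]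

theorem adj_translate (M : Motif A n m) (e : Fin m) (k : Fin d → ℤ) :
    C.graph.Adj (M.label ((M.src e).1, (M.src e).2 + k))
      (M.label ((M.tgt e).1, (M.tgt e).2 + k)) :=
  ((A.isPeriod_latticeVec k).2.2 _ _ _ _ (M.placement_label_add _ _ _)
    (M.placement_label_add _ _ _)).1 (M.adj e)

theorem placement_translate_sub (M : Motif A n m) (e : Fin m) (k : Fin d → ℤ) :
    C.placement (M.label ((M.src e).1, (M.src e).2 + k)) -
      C.placement (M.label ((M.tgt e).1, (M.tgt e).2 + k)) = M.barVec e := by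
  rw [placement_label_add, placement_label_add, add_sub_add_right_eq_sub]
  rfl

/-- Lattice translations preserve adjacency and bar vectors, so the bar equations are indexed by a
motif bar and a translation. -/
theorem mem_flexSpace_iff (M : Motif A n m) (u : V → Fin d → ℂ) :
    u ∈ C.flexSpace ↔ ∀ e k, ∑ j, (u (M.label ((M.src e).1, (M.src e).2 + k)) j -
      u (M.label ((M.tgt e).1, (M.tgt e).2 + k)) j) * ((M.barVec e j : ℝ) : ℂ) = 0 := by
  constructor
  · intro hu e k
    rw [← hu _ _ (M.adj_translate e k)]
    refine Finset.sum_congr rfl fun j _ => ?_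
    rw [← M.placement_translate_sub e k]
    rfl
  · intro hu x y hxy
    obtain ⟨⟨e, k⟩, he, -⟩ := M.existsUnique_bar x y hxy
    have h := hu e k
    rw [← M.placement_translate_sub e k] at h
    rcases Sym2.eq_iff.1 he with ⟨rfl, rfl⟩ | ⟨rfl, rfl⟩
    · exact h
    -- The bar is traversed in the opposite direction: both factors change sign.
    · refine Eq.trans (Finset.sum_congr rfl fun j _ => ?_) h
      simp only [PiLp.sub_apply]
      push_cast
      ring

/-- In `Ψ(z⁻¹)` the exponents are the actual cell labels of the end joints, so multiplication by
`z^k` translates the bar by `k`. Hence the annihilated module is that of `Ψ(z⁻¹)` rather than of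
`Ψ(z)`. -/
theorem pairing_smul_row (M : Motif A n m) (u : V → Fin d → ℂ) (e : Fin m) (k : Fin d → ℤ) :
    M.pairing u ((AddMonoidAlgebra.single k 1 : Laurent d) •
      (M.transferFunction.map (laurentInv d)) e) =
    ∑ j, (u (M.label ((M.src e).1, (M.src e).2 + k)) j -
      u (M.label ((M.tgt e).1, (M.tgt e).2 + k)) j) * ((M.barVec e j : ℝ) : ℂ) := by
  have h : (AddMonoidAlgebra.single k 1 : Laurent d) •
      (M.transferFunction.map (laurentInv d)) e =
      ∑ j, (Pi.single ((M.src e).1, j)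
          (AddMonoidAlgebra.single ((M.src e).2 + k) ((M.barVec e j : ℝ) : ℂ)) -
        Pi.single ((M.tgt e).1, j)
          (AddMonoidAlgebra.single ((M.tgt e).2 + k) ((M.barVec e j : ℝ) : ℂ))) := by
    have hinv : ∀ (l : Fin d → ℤ) (a : ℂ), laurentInv d (AddMonoidAlgebra.single l a) =
        AddMonoidAlgebra.single (-l) a := by
      intro l a
      simp [laurentInv]
    funext ⟨v, i⟩
    rw [Finset.sum_apply, Finset.sum_eq_single i]
    · simp only [Pi.smul_apply, Matrix.map_apply, transferFunction, map_sub, smul_eq_mul,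
        Pi.sub_apply, Pi.single_apply, Prod.mk.injEq, and_true, mul_sub,
        apply_ite (laurentInv d), map_zero, hinv, neg_neg, mul_ite, mul_zero,
        AddMonoidAlgebra.single_mul_single, one_mul, add_comm k]
    · intro j _ hj
      simp [Ne.symm hj]
    · simp
  rw [h, map_sum]
  refine Finset.sum_congr rfl fun j _ => ?_
  rw [map_sub, pairing_single, pairing_single]
  ring

/-- The flex space is the annihilator of the module of the rows of `Ψ(z⁻¹)`. -/
theorem mem_flexSpace_iff_pairing (M : Motif A n m) (u : V → Fin d → ℂ) :
    u ∈ C.flexSpace ↔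
      ∀ g ∈ rowModule (M.transferFunction.map (laurentInv d)), M.pairing u g = 0 := by
  simp_rw [M.mem_flexSpace_iff, ← M.pairing_smul_row]
  constructor
  · intro hu g hg
    -- The pairing is only `ℂ`-linear; quantifying over all multiples lets the span induction pass
    -- through Laurent scalars.
    suffices ∀ s : Laurent d, M.pairing u (s • g) = 0 by simpa using this 1
    induction hg using Submodule.span_induction with
    | mem x hx =>
      obtain ⟨e, rfl⟩ := hx
      intro s
      induction s using AddMonoidAlgebra.induction_linear with
      | zero => simp
      | add f g hf hg => rw [add_smul, map_add, hf, hg, add_zero]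
      | single k a =>
        have : (AddMonoidAlgebra.single k a : Laurent d) = a • AddMonoidAlgebra.single k 1 := by
          rw [AddMonoidAlgebra.smul_single, smul_eq_mul, mul_one]
        rw [this, smul_assoc, map_smul, hu, smul_zero]
    | zero => simp
    | add x y _ _ hx hy =>
      intro s
      rw [smul_add, map_add, hx, hy, add_zero]
    | smul a x _ hx =>
      intro s
      rw [smul_smul]
      exact hx _
  · intro hu e k
    exact hu _ (Submodule.smul_mem _ _ (Submodule.subset_span ⟨e, rfl⟩))

end Motif

theorem CrystalFramework.isClosed_flexSpace {d : ℕ} {V : Type*} (C : CrystalFramework d V) :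
    IsClosed (C.flexSpace : Set (V → Fin d → ℂ)) := by
  have : (C.flexSpace : Set (V → Fin d → ℂ)) = {u | ∀ v w, C.graph.Adj v w →
    ∑ j, (u v j - u w j) * ((C.placement v j - C.placement w j : ℝ) : ℂ) = 0} := rfl
  rw [this]
  simp only [Set.ofPred_forall]
  refine isClosed_iInter fun v => isClosed_iInter fun w => isClosed_iInter fun _ => ?_
  exact isClosed_eq (by fun_prop) continuous_const

/-! ### Points of the torus and the Nullstellensatz -/

/-- The evaluation of Laurent polynomials at a point with nonzero coordinates. -/
noncomputable def laurentEval {d : ℕ} (ω : Fin d → ℂˣ) : Laurent d →ₐ[ℂ] ℂ :=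
  AddMonoidAlgebra.lift ℂ ℂ (Fin d → ℤ)
    { toFun := fun k => ∏ i, ((ω i ^ k.toAdd i : ℂˣ) : ℂ)
      map_one' := by simp
      map_mul' := fun k l => by
        simp only [toAdd_mul, Pi.add_apply, zpow_add, Units.val_mul, Finset.prod_mul_distrib] }

theorem laurentEval_single {d : ℕ} (ω : Fin d → ℂˣ) (k : Fin d → ℤ) (a : ℂ) :
    laurentEval ω (AddMonoidAlgebra.single k a) = a * ∏ i, ((ω i ^ k i : ℂˣ) : ℂ) := by
  simp [laurentEval]

theorem laurentEval_single_one {d : ℕ} (ω : Fin d → ℂˣ) (i : Fin d) :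
    laurentEval ω (AddMonoidAlgebra.single (Pi.single i 1) 1) = ω i := by
  rw [laurentEval_single, one_mul, Finset.prod_eq_single i]
  · simp
  · intro j _ hj
    simp [hj]
  · simp

theorem laurentEval_toLaurent {d : ℕ} (ω : Fin d → ℂˣ) (q : MvPolynomial (Fin d) ℂ) :
    laurentEval ω (toLaurent d q) = MvPolynomial.eval (fun i => (ω i : ℂ)) q := by
  have h : (laurentEval ω).comp (toLaurent d) = MvPolynomial.aeval fun i => (ω i : ℂ) := by
    refine MvPolynomial.algHom_ext fun i => ?_
    simp [toLaurent, laurentEval_single_one]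
  rw [← MvPolynomial.coe_aeval_eq_eval]
  exact congrArg (fun φ => φ q) h

/-- Monomials are units and form a group generated by the variables, so a character is fixed by its
nonzero values on the variables. -/
theorem exists_eq_laurentEval {d : ℕ} (χ : Laurent d →ₐ[ℂ] ℂ) :
    ∃ ω : Fin d → ℂˣ, χ = laurentEval ω := by
  have hu : ∀ k : Fin d → ℤ, χ (AddMonoidAlgebra.single k 1) *
      χ (AddMonoidAlgebra.single (-k) 1) = 1 := by
    intro k
    rw [← map_mul, AddMonoidAlgebra.single_mul_single, add_neg_cancel, one_mul,
      ← AddMonoidAlgebra.one_def, map_one]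
  let ρ : Multiplicative (Fin d → ℤ) →* ℂˣ := MonoidHom.toHomUnits
    ((χ : Laurent d →* ℂ).comp (AddMonoidAlgebra.of ℂ (Fin d → ℤ)))
  have hρ : ∀ k : Fin d → ℤ, ((ρ (Multiplicative.ofAdd k) : ℂˣ) : ℂ) =
      χ (AddMonoidAlgebra.single k 1) := fun k => rfl
  refine ⟨fun i => ρ (Multiplicative.ofAdd (Pi.single i 1)), AddMonoidAlgebra.algHom_ext
    (fun k => ?_) ?_⟩
  · rw [laurentEval_single, one_mul, ← hρ, ← Units.coe_prod]
    congr 1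
    have : Multiplicative.ofAdd k =
        ∏ i, (Multiplicative.ofAdd (Pi.single i 1 : Fin d → ℤ)) ^ k i := by
      simp_rw [← ofAdd_zsmul, ← ofAdd_sum]
      congr 1
      funext j
      simp [Finset.sum_apply, Pi.single_apply]
    rw [this, map_prod]
    simp_rw [map_zpow]
  · ext

/-- Weak Nullstellensatz for Laurent polynomials. -/
theorem exists_laurentEval_eq_zero {d : ℕ} (I : Ideal (Laurent d)) (hI : I ≠ ⊤) :
    ∃ ω : Fin d → ℂˣ, ∀ s ∈ I, laurentEval ω s = 0 := by
  obtain ⟨J, hJ, hIJ⟩ := I.exists_le_maximal hI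
  let _ : Field (Laurent d ⧸ J) := Ideal.Quotient.field J
  have hfin : Algebra.FiniteType ℂ (Laurent d ⧸ J) :=
    .of_surjective (Ideal.Quotient.mkₐ ℂ J) (Ideal.Quotient.mkₐ_surjective ℂ J)
  have := finite_of_finite_type_of_isJacobsonRing ℂ (Laurent d ⧸ J)
  let e : ℂ ≃ₐ[ℂ] (Laurent d ⧸ J) := AlgEquiv.ofBijective (Algebra.ofId ℂ _)
    IsAlgClosed.algebraMap_bijective_of_isIntegral
  obtain ⟨ω, hω⟩ := exists_eq_laurentEval
    ((e.symm : (Laurent d ⧸ J) →ₐ[ℂ] ℂ).comp (Ideal.Quotient.mkₐ ℂ J))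
  refine ⟨ω, fun s hs => ?_⟩
  rw [← hω, AlgHom.comp_apply, Ideal.Quotient.mkₐ_eq_mk, Ideal.Quotient.eq_zero_iff_mem.2 (hIJ hs),
    map_zero]

theorem exists_laurentEval_eq_zero_of_notMem {d : ℕ} {N : Type*} [AddCommGroup N]
    [Module (Laurent d) N] (B : Submodule (Laurent d) N) {f : N} (hf : f ∉ B) :
    ∃ ω : Fin d → ℂˣ, ∀ s : Laurent d, s • f ∈ B → laurentEval ω s = 0 := by
  refine exists_laurentEval_eq_zero (B.comap (LinearMap.toSpanSingleton _ _ f)) fun h => hf ?_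
  have : (1 : Laurent d) ∈ B.comap (LinearMap.toSpanSingleton _ _ f) := h ▸ trivial
  simpa using this

/-! ### Clearing denominators and root sequences -/

/-- Asking for all large exponents, not just one, allows a common monomial for sums and for the
components of a vector. -/
theorem exists_toLaurent_eq_single_mul {d : ℕ} (f : Laurent d) : ∃ N : ℕ, ∀ N', N ≤ N' →
    ∃ q, toLaurent d q = AddMonoidAlgebra.single (fun _ => (N' : ℤ)) 1 * f := by
  induction f using AddMonoidAlgebra.induction_linear with
  | zero => exact ⟨0, fun _ _ => ⟨0, by simp⟩⟩
  | add f g hf hg =>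
    obtain ⟨N, hN⟩ := hf
    obtain ⟨L, hL⟩ := hg
    refine ⟨max N L, fun N' h => ?_⟩
    obtain ⟨q, hq⟩ := hN N' (le_of_max_le_left h)
    obtain ⟨r, hr⟩ := hL N' (le_of_max_le_right h)
    exact ⟨q + r, by rw [map_add, hq, hr, mul_add]⟩
  | single k a =>
    refine ⟨∑ i, (k i).natAbs, fun N' h => ?_⟩
    refine ⟨MvPolynomial.C a * ∏ i, MvPolynomial.X i ^ (N' + k i).toNat, ?_⟩
    have hk : ∀ i, ((N' + k i).toNat : ℤ) = N' + k i := by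
      intro i
      have : (k i).natAbs ≤ ∑ i, (k i).natAbs :=
        Finset.single_le_sum (f := fun i => (k i).natAbs) (fun _ _ => Nat.zero_le _)
          (Finset.mem_univ i)
      omega
    have hp : ∀ i, toLaurent d (MvPolynomial.X i ^ (N' + k i).toNat) =
        AddMonoidAlgebra.single (Pi.single i (N' + k i)) 1 := by
      intro i
      rw [map_pow, toLaurent, MvPolynomial.aeval_X, AddMonoidAlgebra.single_pow, one_pow,
        ← Pi.single_smul, nsmul_eq_mul, mul_one, hk]
    rw [map_mul, map_prod]
    simp_rw [hp]
    rw [← single_eq_prod_single (fun i => N' + k i) fun _ => 1, Finset.prod_const_one,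
      AddMonoidAlgebra.single_mul_single, ← MvPolynomial.algebraMap_eq, AlgHom.commutes,
      ← Algebra.smul_def, AddMonoidAlgebra.smul_single, smul_eq_mul, mul_comm]
    rfl

/-- A root sequence for `B*` detects the vectors outside `B`. -/
theorem IsRootSequence.exists_laurentEval_eq_zero {d : ℕ} {ι : Type*} [Fintype ι]
    {B : Submodule (Laurent d) (ι → Laurent d)} {s : ℕ} {ω : Fin s → Fin d → ℂˣ}
    (h : IsRootSequence (polyPart B) fun i l => (ω i l : ℂ)) {f : ι → Laurent d} (hf : f ∉ B) :
    ∃ i, ∀ r : Laurent d, r • f ∈ B → laurentEval (ω i) r = 0 := by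
  obtain ⟨Q, P, hQ, hP, -, hroot⟩ := h
  by_contra! hcon
  apply hf
  choose N hN using fun c => exists_toLaurent_eq_single_mul (f c)
  -- The sum of the exponents clears all components at once, giving a polynomial multiple `f0` of
  -- `f` by a monomial unit.
  choose f0 hf0 using fun c => hN c (∑ c, N c)
    (Finset.single_le_sum (fun _ _ => Nat.zero_le _) (Finset.mem_univ c))
  have hmem : f0 ∈ polyPart B := by
    rw [hQ, Submodule.mem_iInf]
    intro i
    obtain ⟨r, hr, hr0⟩ := hcon i
    obtain ⟨L, hL⟩ := exists_toLaurent_eq_single_mul r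
    obtain ⟨q, hq⟩ := hL L le_rfl
    have hqf : q • f0 ∈ Q i := by
      have : q • f0 ∈ polyPart B := by
        change (fun c => toLaurent d ((q • f0) c)) ∈ B
        have h1 : (fun c => toLaurent d ((q • f0) c)) =
            (AddMonoidAlgebra.single (fun _ => (L : ℤ)) 1 *
              AddMonoidAlgebra.single (fun _ => ((∑ c, N c : ℕ) : ℤ)) 1 : Laurent d) • r • f := by
          funext c
          simp only [Pi.smul_apply, smul_eq_mul, map_mul, hq, hf0]
          ring
        rw [h1]
        exact B.smul_mem _ hr
      rw [hQ] at this
      exact (Submodule.mem_iInf _).1 this i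
    -- Since `q • f0 ∈ Q i` with `Q i` primary, failure of `f0 ∈ Q i` would put `q` in `P i`. Then
    -- `q`, a monomial times `r`, would vanish at `ω i`, and so would `r`.
    refine ((hP i).1.2 hqf).resolve_right fun hrad => hr0 ?_
    have hqP : q ∈ P i := by
      refine ((hP i).2 q).2 ?_
      obtain ⟨t, ht⟩ := hrad
      exact ⟨t, fun x => Submodule.mem_colon.1 ht x trivial⟩
    have h0 := hroot i q hqP
    rw [← laurentEval_toLaurent, hq, map_mul, laurentEval_single, one_mul, ← Units.coe_prod] at h0
    exact (mul_eq_zero.1 h0).resolve_left (Units.ne_zero _)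
  have hmem' : (AddMonoidAlgebra.single (fun _ => ((∑ c, N c : ℕ) : ℤ)) 1 : Laurent d) • f ∈ B := by
    have h1 : (fun c => toLaurent d (f0 c)) ∈ B := hmem
    simp_rw [hf0] at h1
    exact h1
  have h2 := B.smul_mem
    (AddMonoidAlgebra.single (-fun _ => ((∑ c, N c : ℕ) : ℤ)) 1 : Laurent d) hmem'
  rwa [smul_smul, AddMonoidAlgebra.single_mul_single, neg_add_cancel, one_mul,
    ← AddMonoidAlgebra.one_def, one_smul] at h2

/-! ### The inversion of the variables -/

theorem laurentInv_single {d : ℕ} (k : Fin d → ℤ) (a : ℂ) :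
    laurentInv d (AddMonoidAlgebra.single k a) = AddMonoidAlgebra.single (-k) a := by
  simp [laurentInv]

theorem laurentInv_laurentInv {d : ℕ} (x : Laurent d) : laurentInv d (laurentInv d x) = x := by
  induction x using AddMonoidAlgebra.induction_linear with
  | zero => simp
  | add f g hf hg => rw [map_add, map_add, hf, hg]
  | single k a => rw [laurentInv_single, laurentInv_single, neg_neg]

theorem laurentEval_laurentInv {d : ℕ} (ω : Fin d → ℂˣ) (x : Laurent d) :
    laurentEval ω (laurentInv d x) = laurentEval ω⁻¹ x := by
  induction x using AddMonoidAlgebra.induction_linear with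
  | zero => simp
  | add f g hf hg => simp only [map_add, hf, hg]
  | single k a =>
    rw [laurentInv_single, laurentEval_single, laurentEval_single]
    simp

/-- Componentwise inversion is semilinear over the ring involution `laurentInv` and sends generators
to generators. -/
theorem mem_rowModule_map_laurentInv {d m : ℕ} {ι : Type*} (Ψ : Matrix (Fin m) ι (Laurent d))
    {g : ι → Laurent d} (hg : g ∈ rowModule Ψ) :
    (fun c => laurentInv d (g c)) ∈ rowModule (Ψ.map (laurentInv d)) := by
  induction hg using Submodule.span_induction with
  | mem x hx =>
    obtain ⟨e, rfl⟩ := hx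
    exact Submodule.subset_span ⟨e, rfl⟩
  | zero =>
    simp only [Pi.zero_apply, map_zero]
    exact Submodule.zero_mem _
  | add x y _ _ hx hy =>
    simp only [Pi.add_apply, map_add]
    exact Submodule.add_mem _ hx hy
  | smul a x _ hx =>
    simp only [Pi.smul_apply, smul_eq_mul, map_mul]
    exact Submodule.smul_mem _ (laurentInv d a) hx

theorem mem_rowModule_map_laurentInv_iff {d m : ℕ} {ι : Type*}
    (Ψ : Matrix (Fin m) ι (Laurent d)) {g : ι → Laurent d} :
    (fun c => laurentInv d (g c)) ∈ rowModule Ψ ↔ g ∈ rowModule (Ψ.map (laurentInv d)) := by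
  constructor
  · intro h
    simpa only [laurentInv_laurentInv] using mem_rowModule_map_laurentInv Ψ h
  · intro h
    have h2 := mem_rowModule_map_laurentInv _ h
    have h3 : (Ψ.map (laurentInv d)).map (laurentInv d) = Ψ := by
      ext1 i j
      exact laurentInv_laurentInv _
    rwa [h3] at h2

/-! ### Assembly -/

/-- If the points of `T` detect the vectors outside the module of the rows of `Ψ(z⁻¹)`, then the
flex space is the closed linear span of its vectorial pg-sequences with geometric index in `T`. -/
theorem Motif.topologicalClosure_span_pgField {d : ℕ} {V : Type*} {C : CrystalFramework d V}
    {A : PeriodicStructure C} {n m : ℕ} (M : Motif A n m) (T : Set (Fin d → ℂˣ))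
    (hT : ∀ f, f ∉ rowModule (M.transferFunction.map (laurentInv d)) → ∃ ω ∈ T,
      ∀ s : Laurent d, s • f ∈ rowModule (M.transferFunction.map (laurentInv d)) →
        laurentEval ω s = 0) :
    (Submodule.span ℂ {u : V → Fin d → ℂ |
        u ∈ C.flexSpace ∧ ∃ ω ∈ T, ∃ h, u = M.pgField ω h}).topologicalClosure = C.flexSpace := by
  refine M.topologicalClosure_span_eq _ _ M.mem_flexSpace_iff_pairing C.isClosed_flexSpace _
    (fun u hu => hu.1) fun f hf => ?_
  obtain ⟨ω, hω, hs⟩ := hT f hf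
  obtain ⟨h, hB, hne⟩ := M.exists_pgField_separating _ _ ω (laurentEval_single_one ω) f hs
  exact ⟨_, ⟨(M.mem_flexSpace_iff_pairing _).2 hB, ω, hω, h, rfl⟩, hne⟩

theorem theorem3p4 {d n m : ℕ} {V : Type*} (C : CrystalFramework d V)
    (A : PeriodicStructure C) (M : Motif A n m) :
    (Submodule.span ℂ {u : V → Fin d → ℂ |
        u ∈ C.flexSpace ∧ ∃ ω h, u = M.pgField ω h}).topologicalClosure = C.flexSpace ∧
    (∀ (s : ℕ) (ω : Fin s → Fin d → ℂˣ),
      IsRootSequence (polyPart (rowModule M.transferFunction)) (fun i l => (ω i l : ℂ)) →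
      (Submodule.span ℂ {u : V → Fin d → ℂ |
        u ∈ C.flexSpace ∧ ∃ i h, u = M.pgField (ω i)⁻¹ h}).topologicalClosure = C.flexSpace) ∧
    (∀ (s : ℕ) (ω : Fin s → Fin d → ℂˣ),
      IsRootSequence (polyPart (rowModule (M.transferFunction.map (laurentInv d))))
        (fun i l => (ω i l : ℂ)) →
      (Submodule.span ℂ {u : V → Fin d → ℂ |
        u ∈ C.flexSpace ∧ ∃ i h, u = M.pgField (ω i) h}).topologicalClosure = C.flexSpace) := by
  refine ⟨?_, fun s ω h => ?_, fun s ω h => ?_⟩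
  · simpa using M.topologicalClosure_span_pgField Set.univ fun f hf => by
      simpa using exists_laurentEval_eq_zero_of_notMem _ hf
  · simpa using M.topologicalClosure_span_pgField (Set.range fun i => (ω i)⁻¹) fun f hf => by
      obtain ⟨i, hi⟩ := h.exists_laurentEval_eq_zero
        (fun hf' => hf ((mem_rowModule_map_laurentInv_iff _).1 hf'))
      refine ⟨_, ⟨i, rfl⟩, fun r hr => ?_⟩
      -- Evaluating `r` at the inverse point is evaluating the inverted `r` at `ω i`, and the
      -- inverted `r` multiplies the inverted `f` into the row module of `Ψ(z)`.
      rw [← laurentEval_laurentInv]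
      refine hi _ ?_
      have h1 : (fun c => laurentInv d ((r • f) c)) =
          laurentInv d r • fun c => laurentInv d (f c) := by
        funext c
        simp
      exact h1 ▸ (mem_rowModule_map_laurentInv_iff _).2 hr
  · simpa using M.topologicalClosure_span_pgField (Set.range ω) fun f hf => by
      obtain ⟨i, hi⟩ := h.exists_laurentEval_eq_zero hf
      exact ⟨_, ⟨i, rfl⟩, hi⟩
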